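/- Let $d\ge 2$, $n\ge 2$ and $m\ge 0$ be integers, let $\omega=e^{2\pi i/d}$, and let $$|G_n^{m}\rangle = Z_e^{m}|+\rangle^{\otimes n}=d^{-n/2}\sum_{q_1,\dots,q_n=0}^{d-1}\omega^{m\,q_1\cdots q_n}|q_1\dots q_n\rangle\in(\mathbb C^d)^{\otimes n}$$ be the $n$-qudit elementary hypergraph state, where $|+\rangle=d^{-1/2}\sum_{q=0}^{d-1}|q\rangle$ and $Z_e|q_1\dots q_n\rangle=\omega^{q_1\cdots q_n}|q_1\dots q_n\rangle$. A bipartition $A|B$ is a splitting of the set of $n$ qudits into two disjoint non-empty sets $A$ and $B$. For a unit vector $\psi$ put $$\alpha^{AB}(\psi)=\max|(\langle\phi^A|\otimes\langle\phi^B|)|\psi\rangle|^2,$$ the maximum being over unit vectors $\phi^A$ and $\phi^B$ of the qudits in $A$ and in $B$. Let $\alpha(\psi)=\max_{A|B}\alpha^{AB}(\psi)$ be the maximal squared overlap with pure biseparable states, and let $E(\psi)=\min_{A|B}\bigl(1-\alpha^{AB}(\psi)\bigr)$ be the multipartite entanglement. Write $d=\prod_{i\in\mathcal J}p_i^{\ell_i}$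 with distinct primes $p_i$ and $\ell_i\ge1$, and $\gcd(m,d)=\prod_{i\in\mathcal J}p_i^{k_i}$ with $0\le k_i\le\ell_i$. Then $$\alpha(|G_n^{m}\rangle)=\prod_{i\in\mathcal J}\Bigl[1-(1-\delta_{k_i,\ell_i})\Bigl(1-\frac1{p_i}\Bigr)^{n-1}\sum_{j=0}^{\ell_i-k_i-1}p_i^{-j}\binom{n+j-2}{j}\Bigr],\qquad E(|G_n^{m}\rangle)=1-\alpha(|G_n^{m}\rangle).$$ Moreover, every bipartition $A|B$ with $|A|=n-1$ and $|B|=1$ is optimal, that is, $\alpha^{AB}(|G_n^{m}\rangle)=\alpha(|G_n^{m}\rangle)$, and the square of the largest Schmidt coefficient of $|G_n^{m}\rangle$ with respect to it is also equal to $\alpha(|G_n^{m}\rangle)$. For every bipartition $A|B$, the reduced density matrix $\rho^{A}=\mathrm{Tr}_B|G_n^m\rangle\langle G_n^m|$, written in the computational basis, has infinity norm (largest absolute row sum) $\|\rho^{A}\|_\infty=\alpha(|G_n^{m}\rangle)$. -/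

import Mathlib

open scoped BigOperators

noncomputable section

namespace QuditHypergraph

/-- Strings `q = (q_i)_{i ∈ ι}` with entries in `{0, …, d-1}`: the labels of the computational
basis of a system of `d`-level qudits indexed by `ι`. -/
abbrev Str (ι : Type) (d : ℕ) : Type := ι → Fin d

/-- The Hilbert space of a system of `d`-level qudits indexed by `ι`, i.e. the tensor product of
copies of `ℂ^d`, written in the computational basis (with its Euclidean inner product). -/
abbrev Hilb (ι : Type) [Fintype ι] (d : ℕ) : Type := EuclideanSpace ℂ (Str ι d)

/-- The root of unity `ω = exp(2πi/d)`. -/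
def omega (d : ℕ) : ℂ := Complex.exp (2 * Real.pi * Complex.I / d)

/-- The one-qudit state `|+⟩ = d^{-1/2} ∑_q |q⟩`. -/
def plusLocal (d : ℕ) : EuclideanSpace ℂ (Fin d) :=
  WithLp.toLp 2 fun _ => (((Real.sqrt d)⁻¹ : ℝ) : ℂ)

/-- The global state `⊗_{i} |+⟩_i` on `n` qudits. -/
def plusState (n d : ℕ) : Hilb (Fin n) d :=
  WithLp.toLp 2 fun q => ∏ i, plusLocal d (q i)

/-- The controlled phase gate `Z_e = ∑_q ω^{∏_{i ∈ e} q_i} |q⟩⟨q|`, acting on `n` qudits. -/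
def controlledPhase (n d : ℕ) (e : Finset (Fin n)) : Module.End ℂ (Hilb (Fin n) d) where
  toFun ψ := WithLp.toLp 2 fun q => omega d ^ (∏ i ∈ e, (q i : ℕ)) * ψ q
  map_add' φ ψ := by ext q; simp [mul_add]
  map_smul' c ψ := by ext q; simp [mul_left_comm]

/-- The `n`-qudit elementary hypergraph state `Z_e^m |+⟩^{⊗ n}`, where `e` is the hyperedge that
contains all the vertices and `m` is its multiplicity. -/
def elementaryState (n d m : ℕ) : Hilb (Fin n) d :=
  (controlledPhase n d Finset.univ ^ m) (plusState n d)

/-- The product vector `|a⟩ ⊗ |b⟩`, where `a` is a vector of the qudits in `A` and `b` one of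
the qudits outside `A`. -/
def tensor {n d : ℕ} (A : Finset (Fin n)) (a : Hilb {i // i ∈ A} d) (b : Hilb {i // i ∉ A} d) :
    Hilb (Fin n) d :=
  WithLp.toLp 2 fun q => a (fun i => q i) * b (fun i => q i)

/-- `A` and its complement form a bipartition: both parts are non-empty. -/
def IsBipartition {n : ℕ} (A : Finset (Fin n)) : Prop := A.Nonempty ∧ Aᶜ.Nonempty

/-- `φ` is a pure state that is separable with respect to the bipartition `A | Aᶜ`. -/
def IsSeparable {n d : ℕ} (A : Finset (Fin n)) (φ : Hilb (Fin n) d) : Prop :=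
  ∃ (a : Hilb {i // i ∈ A} d) (b : Hilb {i // i ∉ A} d), ‖a‖ = 1 ∧ ‖b‖ = 1 ∧ φ = tensor A a b

/-- `φ` is a pure biseparable state: it is separable with respect to some bipartition. -/
def IsBiseparable {n d : ℕ} (φ : Hilb (Fin n) d) : Prop :=
  ∃ A : Finset (Fin n), IsBipartition A ∧ IsSeparable A φ

/-- The squared overlaps of `ψ` with the pure states separable with respect to `A | Aᶜ`. -/
def cutOverlaps {n d : ℕ} (A : Finset (Fin n)) (ψ : Hilb (Fin n) d) : Set ℝ :=
  {x | ∃ φ : Hilb (Fin n) d, IsSeparable A φ ∧ x = ‖inner ℂ φ ψ‖ ^ 2}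

/-- The squared overlaps of `ψ` with the pure biseparable states. -/
def biseparableOverlaps {n d : ℕ} (ψ : Hilb (Fin n) d) : Set ℝ :=
  {x | ∃ φ : Hilb (Fin n) d, IsBiseparable φ ∧ x = ‖inner ℂ φ ψ‖ ^ 2}

/-- The bipartite entanglement of `ψ` with respect to `A | Aᶜ`: one minus the maximal squared
overlap with the pure states separable with respect to `A | Aᶜ`. -/
def bipartiteEntanglement {n d : ℕ} (A : Finset (Fin n)) (ψ : Hilb (Fin n) d) : ℝ :=
  1 - sSup (cutOverlaps A ψ)

/-- The multipartite entanglement of `ψ`: the minimum, over all bipartitions, of the bipartite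
entanglement. -/
def multipartiteEntanglement {n d : ℕ} (ψ : Hilb (Fin n) d) : ℝ :=
  ⨅ A : {A : Finset (Fin n) // IsBipartition A}, bipartiteEntanglement A.1 ψ

/-- The string on all the qudits that is `s` on `A` and `t` outside `A`. -/
def glue {n d : ℕ} (A : Finset (Fin n)) (s : Str {i // i ∈ A} d) (t : Str {i // i ∉ A} d) :
    Str (Fin n) d :=
  fun i => if h : i ∈ A then s ⟨i, h⟩ else t ⟨i, h⟩

/-- The coefficients of `ψ`, as a matrix with rows indexed by the strings on `A` and columns
indexed by the strings outside `A`. -/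
def coeffMatrix {n d : ℕ} (A : Finset (Fin n)) (ψ : Hilb (Fin n) d) :
    Matrix (Str {i // i ∈ A} d) (Str {i // i ∉ A} d) ℂ :=
  Matrix.of fun s t => ψ (glue A s t)

/-- The largest Schmidt coefficient of `ψ` with respect to `A | Aᶜ`. The Schmidt coefficients are
the singular values of the coefficient matrix, which Mathlib lists in decreasing order. -/
def maxSchmidtCoeff {n d : ℕ} (A : Finset (Fin n)) (ψ : Hilb (Fin n) d) : ℝ :=
  (Matrix.toEuclideanLin (coeffMatrix A ψ)).singularValues 0

/-- The reduced density matrix on the qudits in `A`: the partial trace of `|ψ⟩⟨ψ|` over the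
qudits outside `A`. -/
def reducedState {n d : ℕ} (A : Finset (Fin n)) (ψ : Hilb (Fin n) d) :
    Matrix (Str {i // i ∈ A} d) (Str {i // i ∈ A} d) ℂ :=
  Matrix.of fun s s' => ∑ t : Str {i // i ∉ A} d,
    ψ (glue A s t) * (starRingEnd ℂ) (ψ (glue A s' t))

/-- The infinity norm of a square matrix: the largest absolute row sum. -/
def infNorm {ι : Type} [Fintype ι] (M : Matrix ι ι ℂ) : ℝ :=
  ⨆ i, ∑ j, ‖M i j‖

/-- The factor of the closed formula that belongs to a prime `p`, where `ℓ` and `k` are the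
exponents of `p` in `d` and in `gcd(m, d)`; the formula is used for `2 ≤ n` and `k ≤ ℓ`. -/
def primeFactorTerm (n p ℓ k : ℕ) : ℝ :=
  1 - (1 - (if k = ℓ then 1 else 0)) * (1 - 1 / (p : ℝ)) ^ (n - 1) *
    ∑ j ∈ Finset.range (ℓ - k), ((p : ℝ) ^ j)⁻¹ * (Nat.choose (n + j - 2) j : ℝ)

/-- The product of these factors over the prime factors of `d`. -/
def alphaFormula (n d m : ℕ) : ℝ :=
  ∏ p ∈ d.primeFactors, primeFactorTerm n p (d.factorization p) ((Nat.gcd m d).factorization p)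

end QuditHypergraph

end

/-
For every state, the largest squared overlap across `A | Aᶜ` is the square `σ₀²` of the largest
singular value of the coefficient matrix `C`. It is an eigenvalue of `ρ = C Cᴴ`, hence at most
`‖ρ‖_∞`. For the hypergraph state every entry of `ρ` is a sum of the form
`∑ t, ω ^ (c * ∏ i, t i)` up to normalization. Such a sum is a nonnegative real, so the row of the
zero string has the largest absolute row sum, and that sum is `d⁻ⁿ ∑ q, ω ^ (m * ∏ i, q i)`, the
same for all cuts. Summing over one coordinate identifies it with the probability that
`m q₁ ⋯ q_{n-1} = 0` in `ℤ/d`. By the Chinese remainder theorem it factors over the primes `p ∣ d`;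
below the truncation level `ℓ` the `p`-adic valuation of a uniform element of `ℤ/p ^ ℓ` is
geometric, so the complementary probability at `p` is a partial sum of a negative binomial law.
For a single qudit against the rest, applying `C` to the uniform vector of that qudit shows that
`σ₀²` attains the bound.
-/

noncomputable section

namespace QuditHypergraph

open Finset

section LargestSingularValue

variable {𝕜 E F : Type*} [RCLike 𝕜]
  [NormedAddCommGroup E] [InnerProductSpace 𝕜 E] [FiniteDimensional 𝕜 E]
  [NormedAddCommGroup F] [InnerProductSpace 𝕜 F] [FiniteDimensional 𝕜 F] (T : E →ₗ[𝕜] F)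

theorem norm_apply_le_singularValues_zero_mul (x : E) :
    ‖T x‖ ≤ T.singularValues 0 * ‖x‖ := by
  set b := T.isSymmetric_adjoint_comp_self.eigenvectorBasis rfl
  have eigen_repr (i) : b.repr (LinearMap.adjoint T (T x)) i =
      ((T.singularValues i ^ 2 : ℝ) : 𝕜) * b.repr x i := by
    rw [T.sq_singularValues_fin rfl i]
    exact T.isSymmetric_adjoint_comp_self.eigenvectorBasis_apply_self_apply rfl x i
  have norm_sq_apply : ‖T x‖ ^ 2 = ∑ i : Fin _, T.singularValues i ^ 2 * ‖b.repr x i‖ ^ 2 := by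
    refine RCLike.ofReal_injective (K := 𝕜) ?_
    rw [RCLike.ofReal_pow, ← inner_self_eq_norm_sq_to_K, ← LinearMap.adjoint_inner_right,
      ← b.repr.inner_map_map, PiLp.inner_apply]
    push_cast
    refine Finset.sum_congr rfl fun i _ => ?_
    rw [eigen_repr, RCLike.inner_apply, mul_assoc, RCLike.mul_conj]
    push_cast
    rfl
  refine (sq_le_sq₀ (norm_nonneg _)
    (mul_nonneg (T.singularValues_nonneg 0) (norm_nonneg x))).1 ?_
  rw [norm_sq_apply, mul_pow, ← b.repr.norm_map x, EuclideanSpace.norm_sq_eq, Finset.mul_sum]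
  gcongr with i
  · exact T.singularValues_nonneg i
  · exact T.singularValues_antitone (Nat.zero_le _)

theorem exists_norm_eq_one_adjoint_apply_apply_eq [Nontrivial E] :
    ∃ x : E, ‖x‖ = 1 ∧ LinearMap.adjoint T (T x) = ((T.singularValues 0 ^ 2 : ℝ) : 𝕜) • x := by
  obtain ⟨x, hx⟩ := (T.hasEigenvalue_adjoint_comp_self_sq_singularValues
    (Module.finrank_pos (R := 𝕜) (M := E))).exists_hasEigenvector
  refine ⟨((‖x‖⁻¹ : ℝ) : 𝕜) • x, ?_, ?_⟩
  · rw [norm_smul, RCLike.norm_ofReal, abs_of_nonneg (by positivity),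
      inv_mul_cancel₀ (norm_ne_zero_iff.2 hx.2)]
  · rw [map_smul, map_smul, smul_comm]
    congr 1
    simpa using hx.apply_eq_smul

theorem norm_apply_eq_of_adjoint_apply_apply_eq {x : E} {c : ℝ} (hc : 0 ≤ c)
    (hx : LinearMap.adjoint T (T x) = ((c ^ 2 : ℝ) : 𝕜) • x) : ‖T x‖ = c * ‖x‖ := by
  refine (sq_eq_sq₀ (norm_nonneg _) (by positivity)).1 (RCLike.ofReal_injective (K := 𝕜) ?_)
  rw [RCLike.ofReal_pow, ← inner_self_eq_norm_sq_to_K, ← LinearMap.adjoint_inner_right, hx,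
    inner_smul_right, inner_self_eq_norm_sq_to_K, mul_pow]
  push_cast
  rfl

end LargestSingularValue

section InfNorm

variable {ι : Type} [Fintype ι]

theorem sum_norm_le_infNorm (M : Matrix ι ι ℂ) (i : ι) : ∑ j, ‖M i j‖ ≤ infNorm M :=
  le_ciSup (Set.finite_range fun i => ∑ j, ‖M i j‖).bddAbove i

theorem infNorm_nonneg (M : Matrix ι ι ℂ) : 0 ≤ infNorm M :=
  Real.iSup_nonneg fun _ => sum_nonneg fun _ _ => norm_nonneg _

theorem infNorm_smul (c : ℂ) (M : Matrix ι ι ℂ) : infNorm (c • M) = ‖c‖ * infNorm M := by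
  simp only [infNorm, Matrix.smul_apply, norm_smul, ← mul_sum,
    Real.mul_iSup_of_nonneg (norm_nonneg c)]

theorem norm_le_infNorm_of_mulVec_eq_smul {M : Matrix ι ι ℂ} {μ : ℂ} {y : ι → ℂ} (hy : y ≠ 0)
    (h : M.mulVec y = μ • y) : ‖μ‖ ≤ infNorm M := by
  obtain ⟨k, hk⟩ := Function.ne_iff.1 hy
  have : Nonempty ι := ⟨k⟩
  obtain ⟨i, hi⟩ := Finite.exists_max fun j => ‖y j‖
  have hyi : 0 < ‖y i‖ := (norm_pos_iff.2 hk).trans_le (hi k)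
  refine le_trans (le_of_mul_le_mul_right ?_ hyi) (sum_norm_le_infNorm M i)
  calc ‖μ‖ * ‖y i‖ = ‖M.mulVec y i‖ := by rw [h, Pi.smul_apply, norm_smul]
    _ ≤ ∑ j, ‖M i j‖ * ‖y j‖ := by
      simp only [Matrix.mulVec, dotProduct, ← norm_mul]
      exact norm_sum_le _ _
    _ ≤ (∑ j, ‖M i j‖) * ‖y i‖ := by
      rw [sum_mul]
      gcongr with j
      exact hi j

end InfNorm

section Cuts

variable {n d : ℕ}

theorem sum_str_eq_sum_glue {M : Type*} [AddCommMonoid M] (A : Finset (Fin n))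
    (f : Str (Fin n) d → M) : ∑ q, f q = ∑ s, ∑ t, f (glue A s t) := by
  rw [← Fintype.sum_prod_type',
    ← (Equiv.piEquivPiSubtypeProd (· ∈ A) fun _ : Fin n => Fin d).symm.sum_comp]
  rfl

theorem glue_coe_mem (A : Finset (Fin n)) (s : Str {i // i ∈ A} d) (t : Str {i // i ∉ A} d)
    (i : {i // i ∈ A}) : glue A s t i = s i :=
  dif_pos i.2

theorem glue_coe_notMem (A : Finset (Fin n)) (s : Str {i // i ∈ A} d) (t : Str {i // i ∉ A} d)
    (i : {i // i ∉ A}) : glue A s t i = t i :=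
  dif_neg i.2

theorem tensor_glue (A : Finset (Fin n)) (a : Hilb {i // i ∈ A} d) (b : Hilb {i // i ∉ A} d)
    (s : Str {i // i ∈ A} d) (t : Str {i // i ∉ A} d) :
    tensor A a b (glue A s t) = a s * b t := by
  simp only [tensor, glue_coe_mem, glue_coe_notMem]

theorem inner_tensor (A : Finset (Fin n)) (a : Hilb {i // i ∈ A} d) (b : Hilb {i // i ∉ A} d)
    (ψ : Hilb (Fin n) d) :
    inner ℂ (tensor A a b) ψ =
      inner ℂ a (Matrix.toEuclideanLin (coeffMatrix A ψ) (WithLp.toLp 2 (star b.ofLp))) := by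
  simp only [PiLp.inner_apply, RCLike.inner_apply, sum_str_eq_sum_glue A, tensor_glue,
    Matrix.toLpLin_apply, Matrix.mulVec, dotProduct, coeffMatrix, Matrix.of_apply, sum_mul,
    map_mul, Pi.star_apply, RCLike.star_def]
  exact sum_congr rfl fun s _ => sum_congr rfl fun t _ => by ring

theorem norm_toLp_star {𝕜 ι : Type*} [RCLike 𝕜] [Fintype ι] (b : EuclideanSpace 𝕜 ι) :
    ‖(WithLp.toLp 2 (star b.ofLp) : EuclideanSpace 𝕜 ι)‖ = ‖b‖ := by
  simp [EuclideanSpace.norm_eq]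

theorem exists_norm_eq_one_inner_eq_norm {𝕜 E : Type*} [RCLike 𝕜] [NormedAddCommGroup E]
    [InnerProductSpace 𝕜 E] [Nontrivial E] (y : E) :
    ∃ a : E, ‖a‖ = 1 ∧ inner 𝕜 a y = (‖y‖ : 𝕜) := by
  by_cases hy : y = 0
  · let := NormedSpace.restrictScalars ℝ 𝕜 E
    obtain ⟨a, ha⟩ := exists_norm_eq E zero_le_one
    exact ⟨a, ha, by simp [hy]⟩
  · refine ⟨(‖y‖ : 𝕜)⁻¹ • y, norm_smul_inv_norm hy, ?_⟩
    have norm_ne_zero : (‖y‖ : 𝕜) ≠ 0 := by simpa using hy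
    rw [inner_smul_left, inner_self_eq_norm_sq_to_K, map_inv₀, RCLike.conj_ofReal, sq,
      inv_mul_cancel_left₀ norm_ne_zero]

theorem isGreatest_cutOverlaps [NeZero d] (A : Finset (Fin n)) (ψ : Hilb (Fin n) d) :
    IsGreatest (cutOverlaps A ψ) (maxSchmidtCoeff A ψ ^ 2) := by
  set T := Matrix.toEuclideanLin (coeffMatrix A ψ)
  constructor
  · obtain ⟨x, hx, hTx⟩ := exists_norm_eq_one_adjoint_apply_apply_eq T
    obtain ⟨a, ha, haT⟩ := exists_norm_eq_one_inner_eq_norm (𝕜 := ℂ) (T x)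
    refine ⟨_, ⟨a, WithLp.toLp 2 (star x.ofLp), ha, (norm_toLp_star x).trans hx, rfl⟩, ?_⟩
    rw [inner_tensor, star_star, WithLp.toLp_ofLp, haT,
      norm_apply_eq_of_adjoint_apply_apply_eq T (T.singularValues_nonneg 0) hTx, hx, mul_one,
      RCLike.norm_ofReal, abs_of_nonneg (T.singularValues_nonneg 0)]
    rfl
  · rintro _ ⟨_, ⟨a, b, ha, hb, rfl⟩, rfl⟩
    gcongr
    calc ‖inner ℂ (tensor A a b) ψ‖ ≤ ‖a‖ * ‖T (WithLp.toLp 2 (star b.ofLp))‖ :=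
          inner_tensor A a b ψ ▸ norm_inner_le_norm _ _
      _ ≤ ‖a‖ * (maxSchmidtCoeff A ψ * ‖b‖) := by
          rw [← norm_toLp_star b]
          gcongr
          exact norm_apply_le_singularValues_zero_mul T _
      _ = maxSchmidtCoeff A ψ := by rw [ha, hb, one_mul, mul_one]

theorem reducedState_eq_mul_conjTranspose (A : Finset (Fin n)) (ψ : Hilb (Fin n) d) :
    reducedState A ψ = coeffMatrix A ψ * (coeffMatrix A ψ).conjTranspose := rfl

theorem sq_maxSchmidtCoeff_le_infNorm [NeZero d] (A : Finset (Fin n)) (ψ : Hilb (Fin n) d) :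
    maxSchmidtCoeff A ψ ^ 2 ≤ infNorm (reducedState A ψ) := by
  obtain ⟨x, hx, hTx⟩ :=
    exists_norm_eq_one_adjoint_apply_apply_eq (Matrix.toEuclideanLin (coeffMatrix A ψ))
  have norm_Tx := norm_apply_eq_of_adjoint_apply_apply_eq _
    ((Matrix.toEuclideanLin (coeffMatrix A ψ)).singularValues_nonneg 0) hTx
  rw [hx, mul_one] at norm_Tx
  by_cases hσ : maxSchmidtCoeff A ψ = 0
  · rw [hσ, zero_pow two_ne_zero]
    exact infNorm_nonneg _
  have eigen : (reducedState A ψ).mulVec ((coeffMatrix A ψ).mulVec x.ofLp) =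
      ((maxSchmidtCoeff A ψ ^ 2 : ℝ) : ℂ) • (coeffMatrix A ψ).mulVec x.ofLp := by
    rw [← Matrix.toEuclideanLin_conjTranspose_eq_adjoint] at hTx
    have := congrArg (fun y => (coeffMatrix A ψ).mulVec (WithLp.ofLp y)) hTx
    simpa [maxSchmidtCoeff, Matrix.toLpLin_apply, reducedState_eq_mul_conjTranspose,
      ← Matrix.mulVec_mulVec, Matrix.mulVec_smul] using this
  have hy : (coeffMatrix A ψ).mulVec x.ofLp ≠ 0 := by
    intro h
    apply hσ
    rw [maxSchmidtCoeff, ← norm_Tx, Matrix.toLpLin_apply, h, WithLp.toLp_zero, norm_zero]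
  simpa using norm_le_infNorm_of_mulVec_eq_smul hy eigen

theorem isGreatest_biseparableOverlaps [NeZero d] {ψ : Hilb (Fin n) d} {α : ℝ}
    {A₀ : Finset (Fin n)} (hA₀ : IsBipartition A₀) (hα : maxSchmidtCoeff A₀ ψ ^ 2 = α)
    (hle : ∀ A, IsBipartition A → maxSchmidtCoeff A ψ ^ 2 ≤ α) :
    IsGreatest (biseparableOverlaps ψ) α := by
  constructor
  · obtain ⟨φ, hφ, h⟩ := (isGreatest_cutOverlaps A₀ ψ).1
    exact ⟨φ, ⟨A₀, hA₀, hφ⟩, hα ▸ h⟩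
  · rintro _ ⟨φ, ⟨A, hA, hφ⟩, rfl⟩
    exact ((isGreatest_cutOverlaps A ψ).2 ⟨φ, hφ, rfl⟩).trans (hle A hA)

theorem multipartiteEntanglement_eq [NeZero d] {ψ : Hilb (Fin n) d} {α : ℝ}
    {A₀ : Finset (Fin n)} (hA₀ : IsBipartition A₀) (hα : maxSchmidtCoeff A₀ ψ ^ 2 = α)
    (hle : ∀ A, IsBipartition A → maxSchmidtCoeff A ψ ^ 2 ≤ α) :
    multipartiteEntanglement ψ = 1 - α := by
  have bipartite (A : Finset (Fin n)) :
      bipartiteEntanglement A ψ = 1 - maxSchmidtCoeff A ψ ^ 2 := by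
    rw [bipartiteEntanglement, (isGreatest_cutOverlaps A ψ).csSup_eq]
  have least : IsLeast (Set.range fun A : {A : Finset (Fin n) // IsBipartition A} =>
      bipartiteEntanglement A.1 ψ) (1 - α) := by
    refine ⟨⟨⟨A₀, hA₀⟩, (bipartite A₀).trans (by rw [hα])⟩, ?_⟩
    rintro _ ⟨A, rfl⟩
    exact (sub_le_sub_left (hle A.1 A.2) 1).trans_eq (bipartite A.1).symm
  exact least.csInf_eq

end Cuts

section AnnihilationProb

variable (ι : Type*) [Fintype ι]

/-- The probability that `c` times the product of a uniformly random family of elements of the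
finite ring `R`, indexed by `ι`, vanishes. -/
def annihilationProb {R : Type*} [CommRing R] (c : R) : ℝ :=
  Nat.card {x : ι → R // c * ∏ i, x i = 0} / Nat.card (ι → R)

theorem annihilationProb_ringEquiv {R S : Type*} [CommRing R] [CommRing S] (e : R ≃+* S) (c : R) :
    annihilationProb ι (e c) = annihilationProb ι c := by
  have map_zeros : ∀ x : ι → R, c * ∏ i, x i = 0 ↔ e c * ∏ i, e (x i) = 0 := fun x => by
    rw [← map_prod, ← map_mul, map_eq_zero_iff e e.injective]
  have card_zeros := Nat.card_congr (Equiv.subtypeEquiv (q := fun y => e c * ∏ i, y i = 0)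
    (Equiv.piCongrRight fun _ : ι => e.toEquiv) map_zeros)
  have card_all := Nat.card_congr (Equiv.piCongrRight fun _ : ι => e.toEquiv)
  rw [annihilationProb, annihilationProb, card_zeros, card_all]

theorem annihilationProb_pi {κ : Type*} [Fintype κ] {R : κ → Type*} [∀ k, CommRing (R k)]
    (c : ∀ k, R k) : annihilationProb ι c = ∏ k, annihilationProb ι (c k) := by
  have swap_zeros : ∀ x : ι → ∀ k, R k, c * ∏ i, x i = 0 ↔ ∀ k, c k * ∏ i, x i k = 0 := fun x => by
    simp [funext_iff]
  have card_zeros := Nat.card_congr <|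
    (Equiv.subtypeEquiv (Equiv.piComm fun _ k => R k) swap_zeros).trans
      (Equiv.subtypePiEquivPi (p := fun k (y : ι → R k) => c k * ∏ i, y i = 0))
  have card_all := Nat.card_congr (Equiv.piComm fun (_ : ι) k => R k)
  rw [annihilationProb, card_zeros, card_all, Nat.card_pi, Nat.card_pi, Nat.cast_prod,
    Nat.cast_prod, ← prod_div_distrib]
  rfl

end AnnihilationProb

section TruncatedValuation

/-- The `p`-adic valuation of `a` truncated at `l`. Since it is read off `gcd (p ^ l) a`, it has
the value `l` at `a = 0`. -/
def truncatedVal (p l a : ℕ) : ℕ := ((p ^ l).gcd a).factorization p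

variable {p : ℕ}

theorem pow_truncatedVal (hp : p.Prime) (l a : ℕ) : p ^ truncatedVal p l a = (p ^ l).gcd a := by
  obtain ⟨j, -, hj⟩ := (Nat.dvd_prime_pow hp).1 (Nat.gcd_dvd_left (p ^ l) a)
  rw [truncatedVal, hj, hp.factorization_pow, Finsupp.single_eq_same]

theorem truncatedVal_eq_iff (hp : p.Prime) {l a j : ℕ} :
    truncatedVal p l a = j ↔ (p ^ l).gcd a = p ^ j := by
  rw [← pow_truncatedVal hp, Nat.pow_right_inj hp.one_lt]

theorem truncatedVal_factorization {d : ℕ} (hd : d ≠ 0) (hp : p.Prime) (m : ℕ) :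
    truncatedVal p (d.factorization p) m = (m.gcd d).factorization p := by
  rcases eq_or_ne m 0 with rfl | hm
  · simp [truncatedVal, hp.factorization_pow]
  · rw [truncatedVal, Nat.factorization_gcd (pow_ne_zero _ hp.ne_zero) hm,
      Nat.factorization_gcd hm hd]
    simp [hp.factorization_pow, min_comm]

theorem dvd_mul_prod_iff_dvd_gcd_mul_prod_gcd {ι : Type*} (N a : ℕ) (s : Finset ι) (x : ι → ℕ) :
    N ∣ a * ∏ i ∈ s, x i ↔ N ∣ N.gcd a * ∏ i ∈ s, N.gcd (x i) := by
  induction s using Finset.cons_induction generalizing a with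
  | empty => simp [Nat.dvd_gcd_iff]
  | cons i s hi ih =>
    rw [prod_cons, prod_cons, ← mul_assoc, ih, Nat.dvd_gcd_mul_iff_dvd_mul, mul_assoc,
      ← Nat.dvd_gcd_mul_iff_dvd_mul, mul_left_comm, ← Nat.dvd_gcd_mul_iff_dvd_mul, mul_left_comm]

theorem pow_dvd_mul_prod_iff (hp : p.Prime) {ι : Type*} [Fintype ι] (l a : ℕ) (x : ι → ℕ) :
    p ^ l ∣ a * ∏ i, x i ↔ l ≤ truncatedVal p l a + ∑ i, truncatedVal p l (x i) := by
  rw [dvd_mul_prod_iff_dvd_gcd_mul_prod_gcd, ← Nat.pow_dvd_pow_iff_le_right hp.one_lt, pow_add,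
    ← prod_pow_eq_pow_sum]
  simp only [pow_truncatedVal hp]

theorem card_truncatedVal_eq (hp : p.Prime) {l j : ℕ} (hj : j ≤ l) [NeZero (p ^ l)] :
    #{x : ZMod (p ^ l) | truncatedVal p l x.val = j} = (p ^ (l - j)).totient := by
  rw [← Nat.pow_div hj hp.pos, Nat.totient_div_of_dvd (pow_dvd_pow p hj)]
  refine card_nbij' ZMod.val Nat.cast ?_ ?_ ?_ ?_
  · intro x hx
    simpa [ZMod.val_lt, truncatedVal_eq_iff hp] using hx
  · intro k hk
    simp only [coe_filter, mem_range, Set.mem_ofPred_eq] at hk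
    simpa [ZMod.val_cast_of_lt hk.1, truncatedVal_eq_iff hp] using hk.2
  · exact fun x _ => ZMod.natCast_zmod_val x
  · intro k hk
    simp only [coe_filter, mem_range, Set.mem_ofPred_eq] at hk
    exact ZMod.val_cast_of_lt hk.1

theorem cast_card_truncatedVal_eq (hp : p.Prime) {l j : ℕ} (hj : j < l) [NeZero (p ^ l)] :
    (#{x : ZMod (p ^ l) | truncatedVal p l x.val = j} : ℝ) =
      p ^ l * (1 - 1 / p) * ((p : ℝ)⁻¹) ^ j := by
  have hp0 : (p : ℝ) ≠ 0 := Nat.cast_ne_zero.2 hp.ne_zero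
  obtain ⟨i, rfl⟩ := Nat.exists_eq_add_of_lt hj
  rw [card_truncatedVal_eq hp hj.le, show j + i + 1 - j = i + 1 by omega,
    Nat.totient_prime_pow_succ hp, Nat.cast_mul, Nat.cast_pred hp.pos, inv_pow]
  push_cast
  field_simp
  ring

end TruncatedValuation

section NegativeBinomial

variable {ι α : Type*} [Fintype ι] [DecidableEq ι] [Fintype α]

theorem card_piAntidiag_univ (j : ℕ) :
    #(piAntidiag (univ : Finset ι) j) = (Fintype.card ι + j - 1).choose j := by
  rw [← map_sym_eq_piAntidiag, card_map, sym_univ, card_univ, Sym.card_sym_eq_choose]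

theorem card_sum_eq (w : α → ℕ) (j : ℕ) :
    #{x : ι → α | ∑ i, w (x i) = j} =
      ∑ v ∈ piAntidiag (univ : Finset ι) j, ∏ i, #{a | w a = v i} := by
  rw [card_eq_sum_card_fiberwise (f := fun x i => w (x i)) (t := piAntidiag univ j)
    fun x hx => by simpa using hx]
  refine sum_congr rfl fun v hv => ?_
  rw [← Fintype.card_piFinset]
  congr 1
  ext x
  simp only [mem_filter, mem_univ, true_and, Fintype.mem_piFinset, funext_iff,
    and_iff_right_iff_imp]
  exact fun h => (sum_congr rfl fun i _ => h i).trans (mem_piAntidiag.1 hv).1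

theorem cast_card_sum_eq_of_geometric {w : α → ℕ} {c r : ℝ} {j : ℕ}
    (hw : ∀ i ≤ j, (#{a | w a = i} : ℝ) = c * r ^ i) :
    (#{x : ι → α | ∑ i, w (x i) = j} : ℝ) =
      c ^ Fintype.card ι * (r ^ j * (Fintype.card ι + j - 1).choose j) := by
  have prod_card : ∀ v ∈ piAntidiag (univ : Finset ι) j,
      ∏ i, (#{a | w a = v i} : ℝ) = c ^ Fintype.card ι * r ^ j := by
    intro v hv
    have hsum : ∑ i, v i = j := (mem_piAntidiag.1 hv).1
    rw [prod_congr rfl fun i _ => hw (v i) (hsum ▸ single_le_sum_of_canonicallyOrdered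
      (mem_univ i)), prod_mul_distrib, prod_const, card_univ, prod_pow_eq_pow_sum, hsum]
  rw [card_sum_eq]
  push_cast
  rw [sum_congr rfl prod_card, sum_const, card_piAntidiag_univ, nsmul_eq_mul]
  ring

theorem cast_card_sum_lt_of_geometric {w : α → ℕ} {c r : ℝ} {N : ℕ}
    (hw : ∀ i < N, (#{a | w a = i} : ℝ) = c * r ^ i) :
    (#{x : ι → α | ∑ i, w (x i) < N} : ℝ) =
      c ^ Fintype.card ι * ∑ j ∈ range N, r ^ j * (Fintype.card ι + j - 1).choose j := by
  rw [card_eq_sum_card_fiberwise (f := fun x => ∑ i, w (x i)) (t := range N)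
    fun x hx => by simpa using hx, Nat.cast_sum, mul_sum]
  refine sum_congr rfl fun j hj => ?_
  have hjN := mem_range.1 hj
  rw [← cast_card_sum_eq_of_geometric fun i hi => hw i (hi.trans_lt hjN), filter_filter]
  congr 3
  ext x
  omega

end NegativeBinomial

section AnnihilationProbZMod

theorem natCast_mul_prod_eq_zero_iff {ι : Type*} [Fintype ι] {p l : ℕ} (hp : p.Prime) (m : ℕ)
    (x : ι → ZMod (p ^ l)) :
    (m : ZMod (p ^ l)) * ∏ i, x i = 0 ↔
      l ≤ truncatedVal p l m + ∑ i, truncatedVal p l (x i).val := by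
  have : NeZero (p ^ l) := ⟨pow_ne_zero l hp.ne_zero⟩
  have cast_prod : (m : ZMod (p ^ l)) * ∏ i, x i = ((m * ∏ i, (x i).val : ℕ) : ZMod (p ^ l)) := by
    simp
  rw [cast_prod, ZMod.natCast_eq_zero_iff, pow_dvd_mul_prod_iff hp]

variable (ι : Type*) [Fintype ι]

theorem annihilationProb_zmod_prime_pow {p : ℕ} (hp : p.Prime) (l m : ℕ) :
    annihilationProb ι (m : ZMod (p ^ l)) =
      primeFactorTerm (Fintype.card ι + 1) p l (truncatedVal p l m) := by
  classical
  have : NeZero (p ^ l) := ⟨pow_ne_zero l hp.ne_zero⟩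
  set k := truncatedVal p l m
  set w : ZMod (p ^ l) → ℕ := fun a => truncatedVal p l a.val
  have zero_iff : ∀ x : ι → ZMod (p ^ l), (m : ZMod (p ^ l)) * ∏ i, x i = 0 ↔
      ¬ ∑ i, w (x i) < l - k := by
    intro x
    rw [natCast_mul_prod_eq_zero_iff hp]
    change l ≤ k + ∑ i, w (x i) ↔ _
    omega
  have card_nonzero : (#{x : ι → ZMod (p ^ l) | ∑ i, w (x i) < l - k} : ℝ) =
      ((p : ℝ) ^ l * (1 - 1 / p)) ^ Fintype.card ι *
        ∑ j ∈ range (l - k), ((p : ℝ)⁻¹) ^ j * (Fintype.card ι + j - 1).choose j :=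
    cast_card_sum_lt_of_geometric fun j hj => cast_card_truncatedVal_eq hp (by omega)
  have card_zero : (#{x : ι → ZMod (p ^ l) | ¬ ∑ i, w (x i) < l - k} : ℝ) =
      (p ^ l) ^ Fintype.card ι - #{x : ι → ZMod (p ^ l) | ∑ i, w (x i) < l - k} := by
    rw [eq_sub_iff_add_eq', ← Nat.cast_add, card_filter_add_card_filter_not, card_univ,
      Fintype.card_fun, ZMod.card]
    push_cast
    rfl
  have hp0 : (p : ℝ) ≠ 0 := Nat.cast_ne_zero.2 hp.ne_zero
  rw [annihilationProb, Nat.card_eq_fintype_card, Nat.card_eq_fintype_card, Fintype.card_fun,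
    ZMod.card, Fintype.card_subtype]
  simp only [zero_iff]
  rw [card_zero, card_nonzero, primeFactorTerm]
  have shift : ∀ j, Fintype.card ι + 1 + j - 2 = Fintype.card ι + j - 1 := fun j => by omega
  simp only [shift, inv_pow, Nat.add_sub_cancel, mul_pow]
  by_cases hk : k = l
  · simp [hk, hp0]
  · rw [if_neg hk]
    push_cast
    field_simp
    ring

theorem annihilationProb_zmod {d : ℕ} (hd : d ≠ 0) (m : ℕ) :
    annihilationProb ι (m : ZMod d) = alphaFormula (Fintype.card ι + 1) d m := by
  rw [← annihilationProb_ringEquiv ι (ZMod.equivPi d hd), map_natCast, annihilationProb_pi,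
    alphaFormula, ← prod_coe_sort d.primeFactors (_ : ℕ → ℝ)]
  refine prod_congr rfl fun p _ => ?_
  rw [Pi.natCast_apply, annihilationProb_zmod_prime_pow ι (Nat.prime_of_mem_primeFactors p.2),
    truncatedVal_factorization hd (Nat.prime_of_mem_primeFactors p.2)]

end AnnihilationProbZMod

section CharacterSums

open scoped ComplexOrder ComplexConjugate

variable {R : Type*} [CommRing R] {ψ : AddChar R ℂ}

section Gram

variable [Finite R]

theorem sum_norm_gram {S T : Type*} [Fintype S] [Fintype T] {f : S → R} {g : T → R}
    (hf : ∀ c, 0 ≤ ∑ s, ψ (c * f s)) (hg : ∀ c, 0 ≤ ∑ t, ψ (c * g t)) (s : S) :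
    ((∑ s', ‖∑ t, ψ (f s * g t) * conj (ψ (f s' * g t))‖ : ℝ) : ℂ) =
      ∑ t, ψ (f s * g t) * ‖∑ s', ψ (g t * f s')‖ := by
  have norm_entry : ∀ s', (‖∑ t, ψ (f s * g t) * conj (ψ (f s' * g t))‖ : ℂ) =
      ∑ t, ψ (f s * g t) * conj (ψ (f s' * g t)) := by
    intro s'
    have entry : ∑ t, ψ (f s * g t) * conj (ψ (f s' * g t)) = ∑ t, ψ ((f s - f s') * g t) := by
      refine sum_congr rfl fun t _ => ?_
      rw [← AddChar.map_neg_eq_conj, ← AddChar.map_add_eq_mul, sub_mul, sub_eq_add_neg]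
    exact RCLike.norm_of_nonneg' (entry ▸ hg _)
  have conj_column : ∀ t, ∑ s', conj (ψ (f s' * g t)) = (‖∑ s', ψ (g t * f s')‖ : ℂ) := by
    intro t
    have norm_column : (‖∑ s', ψ (g t * f s')‖ : ℂ) = ∑ s', ψ (g t * f s') :=
      RCLike.norm_of_nonneg' (hf (g t))
    rw [← map_sum, ← Complex.conj_ofReal, norm_column]
    simp only [mul_comm]
  push_cast
  simp only [norm_entry, ← conj_column, mul_sum]
  exact sum_comm

-- Every row sum combines the same nonnegative weights with unimodular coefficients `ψ (f s * g t)`,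
-- so it is largest at `s₀`, where these coefficients are all `1`.
theorem infNorm_gram {S : Type} {T : Type*} [Fintype S] [Fintype T] {f : S → R} {g : T → R}
    (hf : ∀ c, 0 ≤ ∑ s, ψ (c * f s)) (hg : ∀ c, 0 ≤ ∑ t, ψ (c * g t)) {s₀ : S} (hs₀ : f s₀ = 0) :
    (infNorm (Matrix.of fun s s' => ∑ t, ψ (f s * g t) * conj (ψ (f s' * g t))) : ℂ) =
      ∑ s, ∑ t, ψ (f s * g t) := by
  set G := Matrix.of fun s s' => ∑ t, ψ (f s * g t) * conj (ψ (f s' * g t))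
  have row : ∀ s, ((∑ s', ‖G s s'‖ : ℝ) : ℂ) = ∑ t, ψ (f s * g t) * ‖∑ s', ψ (g t * f s')‖ :=
    sum_norm_gram hf hg
  have row_le : ∀ s, ∑ s', ‖G s s'‖ ≤ ∑ t, ‖∑ s', ψ (g t * f s')‖ := by
    intro s
    calc ∑ s', ‖G s s'‖ = ‖((∑ s', ‖G s s'‖ : ℝ) : ℂ)‖ := by
          rw [Complex.norm_real, Real.norm_of_nonneg (by positivity)]
      _ ≤ ∑ t, ‖∑ s', ψ (g t * f s')‖ := by
          rw [row]
          refine (norm_sum_le _ _).trans_eq (sum_congr rfl fun t _ => ?_)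
          rw [norm_mul, AddChar.norm_apply, one_mul, Complex.norm_real, norm_norm]
  have row_s₀ : ∑ s', ‖G s₀ s'‖ = ∑ t, ‖∑ s', ψ (g t * f s')‖ := by
    apply Complex.ofReal_injective
    rw [row]
    simp [hs₀]
  have : Nonempty S := ⟨s₀⟩
  have infNorm_eq : infNorm G = ∑ t, ‖∑ s', ψ (g t * f s')‖ :=
    le_antisymm (ciSup_le row_le) (row_s₀ ▸ sum_norm_le_infNorm G s₀)
  rw [infNorm_eq, Complex.ofReal_sum, sum_comm]
  refine sum_congr rfl fun t _ => (RCLike.norm_of_nonneg' (hf (g t))).trans ?_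
  simp only [mul_comm]

end Gram

variable [Fintype R]

theorem sum_addChar_mul_prod {ι : Type*} [Fintype ι] [DecidableEq ι] (hψ : ψ.IsPrimitive) (i₀ : ι)
    (c : R) :
    ∑ x : ι → R, ψ (c * ∏ i, x i) =
      ((Fintype.card R ^ Fintype.card ι * annihilationProb {i // i ≠ i₀} c : ℝ) : ℂ) := by
  classical
  have split : ∀ a (y : {i // i ≠ i₀} → R),
      c * ∏ i, (Equiv.funSplitAt i₀ R).symm (a, y) i = a * (c * ∏ i, y i) := by
    intro a y
    have rest : ∏ i : {i // i ≠ i₀}, (Equiv.funSplitAt i₀ R).symm (a, y) i = ∏ i, y i :=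
      Fintype.prod_congr _ _ fun i => by simp [i.2]
    rw [Fintype.prod_eq_mul_prod_compl i₀, prod_subtype (p := (· ≠ i₀)) _ fun i => by simp,
      rest, mul_left_comm]
    simp
  have card_split : Fintype.card (ι → R) = Fintype.card R * Fintype.card ({i // i ≠ i₀} → R) := by
    rw [Fintype.card_congr (Equiv.funSplitAt i₀ R), Fintype.card_prod]
  have card_ne_zero : (Fintype.card ({i // i ≠ i₀} → R) : ℝ) ≠ 0 :=
    Nat.cast_ne_zero.2 Fintype.card_ne_zero
  rw [← (Equiv.funSplitAt i₀ R).symm.sum_comp, Fintype.sum_prod_type_right]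
  simp only [split, AddChar.sum_mulShift _ hψ]
  rw [← Nat.cast_pow, ← Fintype.card_fun, card_split, annihilationProb, Nat.card_eq_fintype_card,
    Nat.card_eq_fintype_card, Fintype.card_subtype, Nat.cast_mul, mul_assoc,
    mul_div_cancel₀ _ card_ne_zero]
  simp [sum_ite, mul_comm]

theorem sum_addChar_mul_prod_nonneg {ι : Type*} [Fintype ι] [DecidableEq ι] [Nonempty ι]
    (hψ : ψ.IsPrimitive) (c : R) : 0 ≤ ∑ x : ι → R, ψ (c * ∏ i, x i) := by
  rw [sum_addChar_mul_prod hψ (Classical.arbitrary ι), Complex.zero_le_real]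
  exact mul_nonneg (by positivity) (div_nonneg (Nat.cast_nonneg _) (Nat.cast_nonneg _))

theorem norm_sum_addChar_mul_sq (hψ : ψ.IsPrimitive) (c : R) :
    ((‖∑ a, ψ (a * c)‖ ^ 2 : ℝ) : ℂ) = Fintype.card R * ∑ a, ψ (a * c) := by
  classical
  rw [AddChar.sum_mulShift c hψ]
  split_ifs <;> simp [sq]

end CharacterSums

section ElementaryState

open scoped ComplexOrder ComplexConjugate

variable {n d m : ℕ} {ι : Type} [Fintype ι]

/-- The product of the entries of the string `s`, as an element of `ℤ/d`: up to the factor `m`, the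
exponent of the phase that the elementary hypergraph state attaches to `s`. -/
def strProd {ι : Type*} [Fintype ι] {d : ℕ} (s : ι → Fin d) : ZMod d := ∏ i, ((s i : ℕ) : ZMod d)

theorem strProd_glue (A : Finset (Fin n)) (s : Str {i // i ∈ A} d) (t : Str {i // i ∉ A} d) :
    strProd (glue A s t) = strProd s * strProd t := by
  rw [strProd, strProd, strProd, ← Fintype.prod_subtype_mul_prod_subtype (· ∈ A)]
  simp only [glue_coe_mem, glue_coe_notMem]
  congr!

variable [NeZero d]

theorem omega_pow (k : ℕ) : omega d ^ k = ZMod.stdAddChar (k : ZMod d) := by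
  rw [← Int.cast_natCast, ZMod.stdAddChar_coe, omega, ← Complex.exp_nat_mul]
  congr 1
  push_cast
  ring

theorem elementaryState_apply (q : Str (Fin n) d) :
    elementaryState n d m q =
      (((√d)⁻¹ ^ n : ℝ) : ℂ) * ZMod.stdAddChar ((m : ZMod d) * strProd q) := by
  have pow_apply : (controlledPhase n d univ ^ m) (plusState n d) q =
      omega d ^ (m * ∏ i, (q i : ℕ)) * plusState n d q := by
    induction m with
    | zero => simp
    | succ k ih =>
      rw [pow_succ', Module.End.mul_apply]
      simp only [controlledPhase, LinearMap.coe_mk, AddHom.coe_mk] at ih ⊢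
      rw [ih, ← mul_assoc, ← pow_add]
      congr 2
      ring
  rw [elementaryState, pow_apply, omega_pow, mul_comm]
  simp [plusState, plusLocal, strProd]

theorem bijective_cast_comp (ι : Type) :
    Function.Bijective fun (s : ι → Fin d) i => ((s i : ℕ) : ZMod d) := by
  have injective : Function.Injective fun k : Fin d => ((k : ℕ) : ZMod d) := fun a b h =>
    Fin.ext (by simpa [ZMod.val_cast_of_lt a.2, ZMod.val_cast_of_lt b.2] using congrArg ZMod.val h)
  exact ((Fintype.bijective_iff_injective_and_card _).2 ⟨injective, by simp⟩).comp_left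

theorem sum_stdAddChar_mul_strProd_eq [DecidableEq ι] (c : ZMod d) :
    ∑ s : Str ι d, ZMod.stdAddChar (c * strProd s) =
      ∑ x : ι → ZMod d, ZMod.stdAddChar (c * ∏ i, x i) :=
  (bijective_cast_comp ι).sum_comp fun x => ZMod.stdAddChar (c * ∏ i, x i)

theorem sum_stdAddChar_mul_strProd_nonneg [DecidableEq ι] [Nonempty ι] (c : ZMod d) :
    0 ≤ ∑ s : Str ι d, ZMod.stdAddChar (c * strProd s) := by
  rw [sum_stdAddChar_mul_strProd_eq]
  exact sum_addChar_mul_prod_nonneg (ZMod.isPrimitive_stdAddChar d) c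

theorem sum_stdAddChar_mul_strProd (hn : n ≠ 0) :
    ∑ q : Str (Fin n) d, ZMod.stdAddChar ((m : ZMod d) * strProd q) =
      ((d ^ n * alphaFormula n d m : ℝ) : ℂ) := by
  have : NeZero n := ⟨hn⟩
  rw [sum_stdAddChar_mul_strProd_eq,
    sum_addChar_mul_prod (ZMod.isPrimitive_stdAddChar d) (0 : Fin n),
    annihilationProb_zmod _ (NeZero.ne d), ZMod.card, Fintype.card_fin,
    Fintype.card_subtype_compl]
  simp [Nat.sub_add_cancel (Nat.one_le_iff_ne_zero.2 hn)]

theorem amplitude_sq_mul (n : ℕ) : ((√d)⁻¹ ^ n) ^ 2 * (d : ℝ) ^ n = 1 := by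
  rw [pow_right_comm, inv_pow, Real.sq_sqrt (Nat.cast_nonneg d), ← mul_pow,
    inv_mul_cancel₀ (NeZero.ne (d : ℝ)), one_pow]

theorem reducedState_elementaryState (A : Finset (Fin n)) :
    reducedState A (elementaryState n d m) =
      ((((√d)⁻¹ ^ n) ^ 2 : ℝ) : ℂ) • Matrix.of fun s s' =>
        ∑ t : Str {i // i ∉ A} d, ZMod.stdAddChar ((m : ZMod d) * strProd s * strProd t) *
          conj (ZMod.stdAddChar ((m : ZMod d) * strProd s' * strProd t)) := by
  ext s s'
  simp only [reducedState, Matrix.of_apply, Matrix.smul_apply, elementaryState_apply,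
    strProd_glue, smul_eq_mul, mul_sum, map_mul, Complex.conj_ofReal, mul_assoc]
  refine sum_congr rfl fun t _ => ?_
  push_cast
  ring

theorem infNorm_reducedState_elementaryState {A : Finset (Fin n)} (hA : IsBipartition A) :
    infNorm (reducedState A (elementaryState n d m)) = alphaFormula n d m := by
  obtain ⟨⟨i, hi⟩, ⟨j, hj⟩⟩ := hA
  have : Nonempty {i // i ∈ A} := ⟨⟨i, hi⟩⟩
  have : Nonempty {i // i ∉ A} := ⟨⟨j, mem_compl.1 hj⟩⟩
  have nonneg : ∀ c : ZMod d,
      0 ≤ ∑ s : Str {i // i ∈ A} d, ZMod.stdAddChar (c * ((m : ZMod d) * strProd s)) := by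
    intro c
    simp only [← mul_assoc]
    exact sum_stdAddChar_mul_strProd_nonneg _
  have zero_string : (m : ZMod d) * strProd (0 : Str {i // i ∈ A} d) = 0 := by
    rw [strProd, prod_eq_zero (mem_univ ⟨i, hi⟩) (by simp), mul_zero]
  have gram := infNorm_gram (ψ := ZMod.stdAddChar) nonneg
    (sum_stdAddChar_mul_strProd_nonneg (ι := {i // i ∉ A})) zero_string
  apply Complex.ofReal_injective
  rw [reducedState_elementaryState, infNorm_smul, Complex.ofReal_mul, gram]
  simp only [mul_assoc, ← strProd_glue]
  rw [← sum_str_eq_sum_glue A fun q => ZMod.stdAddChar ((m : ZMod d) * strProd q),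
    sum_stdAddChar_mul_strProd (Fin.pos i).ne', ← Complex.ofReal_mul, Complex.norm_real,
    Real.norm_of_nonneg (by positivity), ← mul_assoc, amplitude_sq_mul, one_mul]

theorem norm_sum_stdAddChar_mul_strProd_sq [Unique ι] [DecidableEq ι] (c : ZMod d) :
    ((‖∑ t : Str ι d, ZMod.stdAddChar (c * strProd t)‖ ^ 2 : ℝ) : ℂ) =
      d * ∑ t : Str ι d, ZMod.stdAddChar (c * strProd t) := by
  have sum_eq : ∑ t : Str ι d, ZMod.stdAddChar (c * strProd t) =
      ∑ a : ZMod d, ZMod.stdAddChar (a * c) := by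
    rw [sum_stdAddChar_mul_strProd_eq, ← (Equiv.funUnique ι (ZMod d)).symm.sum_comp]
    simp [mul_comm]
  rw [sum_eq, norm_sum_addChar_mul_sq (ZMod.isPrimitive_stdAddChar d), ZMod.card]

theorem sum_norm_sum_stdAddChar_mul_strProd_sq (v : Fin n) :
    ∑ s : Str {i // i ∈ ({v}ᶜ : Finset (Fin n))} d,
      ‖∑ t : Str {i // i ∉ ({v}ᶜ : Finset (Fin n))} d,
        ZMod.stdAddChar ((m : ZMod d) * strProd s * strProd t)‖ ^ 2 =
      d * (d ^ n * alphaFormula n d m) := by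
  let _ : Unique {i // i ∉ ({v}ᶜ : Finset (Fin n))} :=
    ⟨⟨⟨v, by simp⟩⟩, fun i => Subtype.ext (by simpa using i.2)⟩
  apply Complex.ofReal_injective
  rw [Complex.ofReal_sum]
  simp only [norm_sum_stdAddChar_mul_strProd_sq, ← mul_sum]
  simp only [mul_assoc, ← strProd_glue]
  rw [← sum_str_eq_sum_glue _ fun q => ZMod.stdAddChar ((m : ZMod d) * strProd q),
    sum_stdAddChar_mul_strProd (Fin.pos v).ne', ← Complex.ofReal_natCast, ← Complex.ofReal_mul]

theorem alphaFormula_le_sq_maxSchmidtCoeff (v : Fin n) :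
    alphaFormula n d m ≤ maxSchmidtCoeff {v}ᶜ (elementaryState n d m) ^ 2 := by
  set T := Matrix.toEuclideanLin (coeffMatrix {v}ᶜ (elementaryState n d m))
  set u : Hilb {i // i ∉ ({v}ᶜ : Finset (Fin n))} d := WithLp.toLp 2 fun _ => 1
  have norm_u : ‖u‖ ^ 2 = d := by
    simp [u, EuclideanSpace.norm_sq_eq]
  have apply_u : ∀ s, T u s = (((√d)⁻¹ ^ n : ℝ) : ℂ) *
      ∑ t : Str {i // i ∉ ({v}ᶜ : Finset (Fin n))} d,
        ZMod.stdAddChar ((m : ZMod d) * strProd s * strProd t) := by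
    intro s
    simp [T, u, Matrix.toLpLin_apply, Matrix.mulVec, dotProduct, coeffMatrix,
      elementaryState_apply, strProd_glue, mul_sum, mul_assoc]
  have norm_Tu : ‖T u‖ ^ 2 = alphaFormula n d m * d := by
    simp only [EuclideanSpace.norm_sq_eq, apply_u, norm_mul, mul_pow, ← mul_sum,
      sum_norm_sum_stdAddChar_mul_strProd_sq]
    rw [Complex.norm_real, Real.norm_of_nonneg (by positivity)]
    linear_combination (alphaFormula n d m * d) * amplitude_sq_mul (d := d) n
  have hT := pow_le_pow_left₀ (norm_nonneg _) (norm_apply_le_singularValues_zero_mul T u) 2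
  rw [mul_pow, norm_u, norm_Tu] at hT
  exact le_of_mul_le_mul_right hT (Nat.cast_pos.2 (NeZero.pos d))

theorem sq_maxSchmidtCoeff_elementaryState_le {A : Finset (Fin n)} (hA : IsBipartition A) :
    maxSchmidtCoeff A (elementaryState n d m) ^ 2 ≤ alphaFormula n d m :=
  (sq_maxSchmidtCoeff_le_infNorm A _).trans_eq (infNorm_reducedState_elementaryState hA)

theorem isBipartition_compl_singleton (hn : 2 ≤ n) (v : Fin n) :
    IsBipartition ({v}ᶜ : Finset (Fin n)) := by
  refine ⟨card_pos.1 ?_, by simp⟩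
  rw [card_compl, Fintype.card_fin, card_singleton]
  omega

theorem sq_maxSchmidtCoeff_compl_singleton (hn : 2 ≤ n) (v : Fin n) :
    maxSchmidtCoeff {v}ᶜ (elementaryState n d m) ^ 2 = alphaFormula n d m :=
  (sq_maxSchmidtCoeff_elementaryState_le (isBipartition_compl_singleton hn v)).antisymm
    (alphaFormula_le_sq_maxSchmidtCoeff v)

end ElementaryState

end QuditHypergraph

end

/-- The maximal squared overlap of the elementary hypergraph state with the pure biseparable states
and its multipartite entanglement. The last three clauses say that every cut into `n - 1` qudits
and one qudit is optimal, and that its largest squared Schmidt coefficient equals the infinity norm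
of the reduced state of every proper non-empty set of qudits. -/
theorem theorem2 (n d m : ℕ) (hn : 2 ≤ n) (hd : 2 ≤ d) :
    IsGreatest (QuditHypergraph.biseparableOverlaps (QuditHypergraph.elementaryState n d m))
      (QuditHypergraph.alphaFormula n d m) ∧
    QuditHypergraph.multipartiteEntanglement (QuditHypergraph.elementaryState n d m) =
      1 - QuditHypergraph.alphaFormula n d m ∧
    (∀ v : Fin n,
      IsGreatest (QuditHypergraph.cutOverlaps {v}ᶜ (QuditHypergraph.elementaryState n d m))
        (QuditHypergraph.alphaFormula n d m)) ∧
    (∀ v : Fin n,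
      QuditHypergraph.maxSchmidtCoeff {v}ᶜ (QuditHypergraph.elementaryState n d m) ^ 2 =
        QuditHypergraph.alphaFormula n d m) ∧
    (∀ A : Finset (Fin n), QuditHypergraph.IsBipartition A →
      QuditHypergraph.infNorm
          (QuditHypergraph.reducedState A (QuditHypergraph.elementaryState n d m)) =
        QuditHypergraph.alphaFormula n d m) := by
  have : NeZero d := ⟨by omega⟩
  have hle (A : Finset (Fin n)) (hA : QuditHypergraph.IsBipartition A) :=
    QuditHypergraph.sq_maxSchmidtCoeff_elementaryState_le (d := d) (m := m) hA
  have hcut (v : Fin n) :=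
    QuditHypergraph.sq_maxSchmidtCoeff_compl_singleton (d := d) (m := m) hn v
  have hv₀ := QuditHypergraph.isBipartition_compl_singleton hn ⟨0, by omega⟩
  exact ⟨QuditHypergraph.isGreatest_biseparableOverlaps hv₀ (hcut _) hle,
    QuditHypergraph.multipartiteEntanglement_eq hv₀ (hcut _) hle,
    fun v => hcut v ▸ QuditHypergraph.isGreatest_cutOverlaps {v}ᶜ _,
    hcut,
    fun _ hA => QuditHypergraph.infNorm_reducedState_elementaryState hA⟩
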